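/- Notation: inequalities $\preceq,\prec$ between real vectors, absolute values $|\cdot|$ of (real or complex) vectors and matrices, maxima and limits superior are all componentwise; $\prec$ means strict inequality in every component. Let $n\ge 0$, $N\ge 1$, $\bar\tau\ge 0$. For $i=1,\dots,N$ let $A_i\in\mathbb{R}^{n\times n}$, $H_i\in\mathbb{R}^{n\times k_i}$, and let $\delta_i:\mathbb{R}^n_{+0}\to\mathbb{R}^{k_i}_{+0}$ be continuous and monotone ($0\preceq x\preceq y$ implies $\delta_i(x)\preceq\delta_i(y)$), where $\mathbb{R}_{+0}=[0,\infty)$. Consider the switching system $$\dot x(t)=A_{\sigma(t)}x(t)+H_{\sigma(t)}w_{\sigma(t)}(t),\qquad t\ge 0,$$ with an arbitrary switching function $\sigma$ with values in $\{1,\dots,N\}$ and perturbations satisfying $$|w_i(t)|\preceq\delta_i(\theta(t))\quad\text{for all } t\ge 0 \text{ and all } i,\qquad \theta(t)=\max_{t-\bar\tau\le s\le t}|x(s)|.$$ A trajectory is a function $x$, continuous on $[-\bar\tau,\infty)$ and locally absolutely continuous on $[0,\infty)$, that satisfies the differential equation for almost every $t\ge 0$, for some such $\sigma$ and $w_i$.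 Let $V\in\mathbb{C}^{n\times n}$ be invertible. For $M\in\mathbb{C}^{n\times n}$ let $\mathcal{M}(M)$ be the real matrix with diagonal entries $\mathrm{Re}\,M_{jj}$ and off-diagonal entries $|M_{jl}|$, and let $\Lambda=\max_i\mathcal{M}(V^{-1}A_iV)$ (entrywise). Suppose that $\Lambda$ is Hurwitz (all its eigenvalues have negative real part). Let $\delta:\mathbb{R}^n_{+0}\to\mathbb{R}^n_{+0}$ be continuous and monotone with $$\delta(y)\succeq\psi(y):=\max_i\ \max_{w\in\mathbb{R}^{k_i},\,|w|\preceq\delta_i(|V|y)}|V^{-1}H_iw|\qquad\text{for all } y\in\mathbb{R}^n_{+0},$$ and put $T_\gamma(y)=-\Lambda^{-1}\delta(y)+\gamma$ for $\gamma,y\in\mathbb{R}^n_{+0}$. Call a pair $\beta,\gamma\in\mathbb{R}^n_{+0}$ suitable for $\xi\in\mathbb{R}^n_{+0}$ if $$\xi\preceq T_\gamma(\beta)\qquad\text{and}\qquad -\Lambda^{-1}\bigl[\delta(\beta)+\max\{-\Lambda\gamma,0\}\bigr]\prec\beta .$$ Suppose that for every $\xi\in\mathbb{R}^n_{+0}$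 there is a suitable pair. Then for every trajectory $x$, with $\xi=\max_{-\bar\tau\le t\le 0}|V^{-1}x(t)|$, there is a pair suitable for $\xi$; and for every such pair $(\beta,\gamma)$ the limit $\lim_{k\to\infty}T_0^k(\beta)$ exists, the function $|V^{-1}x(t)|$ is bounded as $t\to\infty$, and $$\limsup_{t\to\infty}|V^{-1}x(t)|\preceq\lim_{k\to\infty}T_0^k(\beta).$$ -/

import Mathlib

open MeasureTheory Filter Topology
open scoped Matrix

noncomputable section

namespace Switching

/-- The nonnegative orthant. (For real vectors, `≤` is the componentwise order.) -/
def orthant (n : ℕ) : Set (Fin n → ℝ) := {x | 0 ≤ x}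

/-- Strict componentwise inequality between real vectors (in every component). -/
def SLt {n : ℕ} (x y : Fin n → ℝ) : Prop := ∀ j, x j < y j

/-- Componentwise magnitude of a complex vector. -/
def cabs {n : ℕ} (z : Fin n → ℂ) : Fin n → ℝ := fun j => ‖z j‖

/-- Monotonicity on the nonnegative orthant: `0 ≤ x ≤ y` implies `f x ≤ f y`.
(This is the property called "CNI" in the source.) -/
def CNI {n m : ℕ} (f : (Fin n → ℝ) → Fin m → ℝ) : Prop :=
  ∀ x ∈ orthant n, ∀ y ∈ orthant n, x ≤ y → f x ≤ f y

/-- Componentwise maximum over `s` of a family of real vectors. -/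
def vmax {α : Type*} {n : ℕ} (s : Set α) (f : α → Fin n → ℝ) : Fin n → ℝ :=
  fun j => sSup ((fun a => f a j) '' s)

/-- Complexification of a real matrix. -/
def toC {m n : ℕ} (A : Matrix (Fin m) (Fin n) ℝ) : Matrix (Fin m) (Fin n) ℂ :=
  A.map Complex.ofReal

/-- Complexification of a real vector. -/
def vecC {n : ℕ} (x : Fin n → ℝ) : Fin n → ℂ := fun j => (x j : ℂ)

/-- `|V⁻¹ x|`, componentwise. -/
def coordAbs {n : ℕ} (V : Matrix (Fin n) (Fin n) ℂ) (x : Fin n → ℝ) : Fin n → ℝ :=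
  cabs (V⁻¹ *ᵥ vecC x)

/-- The Metzler matrix of a complex matrix: real parts on the diagonal, magnitudes off it. -/
def metzlerPart {n : ℕ} (M : Matrix (Fin n) (Fin n) ℂ) : Matrix (Fin n) (Fin n) ℝ :=
  Matrix.of fun j l => if j = l then (M j l).re else ‖M j l‖

/-- All (complex) eigenvalues have negative real part. -/
def IsHurwitz {n : ℕ} (L : Matrix (Fin n) (Fin n) ℝ) : Prop :=
  ∀ μ ∈ spectrum ℂ (toC L), μ.re < 0

/-- The data of a switching perturbed system with state dimension `n` and `N` modes: the matrices
`A i`, `H i`, the continuous nonnegative perturbation bounds `δ i`, and the maximum delay `τ`.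
The functions `δ i` matter only on the nonnegative orthant. -/
structure System (n N : ℕ) where
  k : Fin N → ℕ
  A : Fin N → Matrix (Fin n) (Fin n) ℝ
  H : (i : Fin N) → Matrix (Fin n) (Fin (k i)) ℝ
  δ : (i : Fin N) → (Fin n → ℝ) → Fin (k i) → ℝ
  τ : ℝ
  δ_continuousOn : ∀ i, ContinuousOn (δ i) (orthant n)
  δ_nonneg : ∀ i, ∀ x ∈ orthant n, 0 ≤ δ i x
  τ_nonneg : 0 ≤ τ

variable {n N : ℕ}

/-- `θ(t)`, the componentwise maximum of `|x|` over `[t - τ, t]`. -/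
def System.theta (S : System n N) (x : ℝ → Fin n → ℝ) (t : ℝ) : Fin n → ℝ :=
  vmax (Set.Icc (t - S.τ) t) fun s => |x s|

/-- `x` is a trajectory on `[-τ, ∞)` under the switching function `σ` and the perturbations `w`:
`x` is continuous on `[-τ, ∞)`, it is a Carathéodory solution of
`x' = A_σ x + H_σ w_σ` on `[0, ∞)` (locally absolutely continuous, with the equation holding
almost everywhere), and `|w i t| ≤ δ i (θ t)` for all `t ≥ 0` and all `i`. -/
structure System.IsTrajectory (S : System n N) (σ : ℝ → Fin N)
    (w : (i : Fin N) → ℝ → Fin (S.k i) → ℝ) (x : ℝ → Fin n → ℝ) : Prop where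
  continuousOn : ContinuousOn x (Set.Ici (-S.τ))
  absolutelyContinuous : ∀ T : ℝ, 0 ≤ T → AbsolutelyContinuousOnInterval x 0 T
  ode : ∀ᵐ t : ℝ, 0 ≤ t →
    HasDerivAt x (S.A (σ t) *ᵥ x t + S.H (σ t) *ᵥ w (σ t) t) t
  bound : ∀ t : ℝ, 0 ≤ t → ∀ i, |w i t| ≤ S.δ i (S.theta x t)

/-- `Λ`, the entrywise maximum over the modes of the Metzler matrices of `V⁻¹ A_i V`. -/
def System.Lam [NeZero N] (S : System n N) (V : Matrix (Fin n) (Fin n) ℂ) :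
    Matrix (Fin n) (Fin n) ℝ :=
  Matrix.of fun j l => Finset.univ.sup' Finset.univ_nonempty fun i : Fin N =>
    metzlerPart (V⁻¹ * toC (S.A i) * V) j l

/-- `ψ(y) = max_i max_{|w| ≤ δ_i(|V| y)} |V⁻¹ H_i w|`, all maxima componentwise. -/
def System.psi [NeZero N] (S : System n N) (V : Matrix (Fin n) (Fin n) ℂ) (y : Fin n → ℝ) :
    Fin n → ℝ :=
  fun j => Finset.univ.sup' Finset.univ_nonempty fun i : Fin N =>
    vmax {w : Fin (S.k i) → ℝ | |w| ≤ S.δ i (V.map (fun z => ‖z‖) *ᵥ y)}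
      (fun w => coordAbs V (S.H i *ᵥ w)) j

/-- `T_γ(y) = -Λ⁻¹ δ(y) + γ`. -/
def T (L : Matrix (Fin n) (Fin n) ℝ) (d : (Fin n → ℝ) → Fin n → ℝ) (γ y : Fin n → ℝ) :
    Fin n → ℝ :=
  (-L⁻¹) *ᵥ d y + γ

/-- `β, γ ≥ 0` are suitable for `ξ`: `ξ ≤ T_γ(β)` and `-Λ⁻¹ [δ(β) + max {-Λ γ, 0}] ≺ β`. -/
structure Suitable (L : Matrix (Fin n) (Fin n) ℝ) (d : (Fin n → ℝ) → Fin n → ℝ)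
    (ξ β γ : Fin n → ℝ) : Prop where
  β_mem : β ∈ orthant n
  γ_mem : γ ∈ orthant n
  le_T : ξ ≤ T L d γ β
  slt : SLt ((-L⁻¹) *ᵥ (d β + (-(L *ᵥ γ)) ⊔ 0)) β

end Switching

end

noncomputable section

namespace Switching

variable {n N : ℕ}

/-! ### Absolutely continuous functions -/

/-! The vector q(t) = |V⁻¹x(t)| satisfies, component by component and wherever that component is
positive, the differential inequality q' ≤ Λq + δ(Y) as long as Y bounds q on the delay window
(`System.IsTrajectory.deriv_coordAbs_le`). Since Λ is Metzler, such inequalities can be compared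
with supersolutions (`IsMetzler.nonpos_of_deriv_le`, `IsMetzler.le_add_exp_of_deriv_le`); since Λ is
also Hurwitz, -Λ⁻¹ preserves order (`IsMetzler.neg_inv_mulVec_pos` and its corollaries).

A suitable pair yields η = -Λ⁻¹[δ(β) + max{-Λγ, 0}], which dominates ξ, lies strictly below β and
satisfies Λη + δ(β) ≤ 0. If q ever reached β in some component, then up to the first such time η
would be a supersolution, so q ≤ η ≺ β there, a contradiction. Hence q ≤ β forever.

An asymptotic bound Y improves to T₀(Y): once the delay window lies past the time where q ≤ Y + ε₁,
q stays below T₀(Y + ε₁) plus an exponentially decaying term, and T₀ is continuous on the orthant.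
Iterating from β gives limsup q ≤ T₀ᵏ(β) for every k. The iterates decrease because T₀(β) ≤ β and T₀
is monotone, and they are nonnegative, so they converge. -/

theorem absolutelyContinuousOnInterval_of_dist_le {X Y : Type*} [PseudoMetricSpace X]
    [PseudoMetricSpace Y] {f : ℝ → X} {g : ℝ → Y} {a b K : ℝ}
    (hf : AbsolutelyContinuousOnInterval f a b)
    (h : ∀ s t, dist (g s) (g t) ≤ K * dist (f s) (f t)) :
    AbsolutelyContinuousOnInterval g a b := by
  refine squeeze_zero (fun E => Finset.sum_nonneg fun i _ => dist_nonneg) (fun E => ?_)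
    (by simpa using Tendsto.const_mul K hf)
  rw [Finset.mul_sum]
  exact Finset.sum_le_sum fun i _ => h _ _

theorem absolutelyContinuousOnInterval_sum {ι : Type*} {f : ι → ℝ → ℝ} {a b : ℝ} (s : Finset ι)
    (h : ∀ i ∈ s, AbsolutelyContinuousOnInterval (f i) a b) :
    AbsolutelyContinuousOnInterval (fun t => ∑ i ∈ s, f i t) a b := by
  classical
  induction s using Finset.induction_on with
  | empty =>
    simpa using (contDiff_const (c := (0 : ℝ)) (n := 1)).contDiffOn.absolutelyContinuousOnInterval
      (a := a) (b := b)
  | insert i s hi ih =>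
    simp only [Finset.sum_insert hi]
    exact (h i (Finset.mem_insert_self i s)).fun_add
      (ih fun j hj => h j (Finset.mem_insert_of_mem hj))

theorem le_of_ae_deriv_nonpos {f : ℝ → ℝ} {a b : ℝ} (hab : a ≤ b)
    (hf : AbsolutelyContinuousOnInterval f a b)
    (h : ∀ᵐ t, t ∈ Set.Ioo a b → deriv f t ≤ 0) : f b ≤ f a := by
  have h1 := hf.integral_deriv_eq_sub
  have h2 : ∫ t in a..b, deriv f t ≤ 0 := by
    rw [intervalIntegral.integral_of_le hab, integral_Ioc_eq_integral_Ioo]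
    exact setIntegral_nonpos_ae measurableSet_Ioo h
  linarith

/-- Squaring removes the kink of the positive part at 0, so sums of these terms can serve as a
Lyapunov function. -/
theorem hasDerivAt_max_zero_sq (x : ℝ) :
    HasDerivAt (fun y : ℝ => (max y 0) ^ 2) (2 * max x 0) x := by
  rcases lt_trichotomy x 0 with hx | rfl | hx
  · rw [max_eq_right hx.le, mul_zero]
    refine (hasDerivAt_const x (0 : ℝ)).congr_of_eventuallyEq ?_
    filter_upwards [gt_mem_nhds hx] with y hy
    simp [max_eq_right hy.le]
  · rw [hasDerivAt_iff_isLittleO_nhds_zero]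
    simp only [zero_add, max_self, mul_zero, smul_zero, sub_zero, ne_eq, OfNat.ofNat_ne_zero,
      not_false_eq_true, zero_pow]
    refine Asymptotics.IsBigO.trans_isLittleO (g := fun h : ℝ => h ^ 2) ?_ ?_
    · refine Asymptotics.isBigO_of_le _ fun y => ?_
      rw [norm_pow, norm_pow]
      refine pow_le_pow_left₀ (norm_nonneg _) ?_ 2
      rw [Real.norm_eq_abs, Real.norm_eq_abs, abs_of_nonneg (le_max_right _ _)]
      exact max_le (le_abs_self y) (abs_nonneg y)
    · simpa using Asymptotics.isLittleO_pow_pow (𝕜 := ℝ) (m := 1) (n := 2) (by norm_num)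
  · rw [max_eq_left hx.le]
    have h := hasDerivAt_pow 2 x
    simp only [Nat.cast_ofNat, Nat.add_one_sub_one, pow_one] at h
    refine h.congr_of_eventuallyEq ?_
    filter_upwards [lt_mem_nhds hx] with y hy
    simp [max_eq_left hy.le]

/-! ### Metzler matrices -/

/-- A Metzler matrix: nonnegative entries off the diagonal. -/
def IsMetzler (M : Matrix (Fin n) (Fin n) ℝ) : Prop := ∀ j l, j ≠ l → 0 ≤ M j l

/-- Comparison principle: the nonpositive orthant is invariant under `p' ≤ M p`. -/
theorem IsMetzler.nonpos_of_deriv_le {M : Matrix (Fin n) (Fin n) ℝ} (hM : IsMetzler M)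
    {p : ℝ → Fin n → ℝ} {a b : ℝ} (hab : a ≤ b)
    (hp : ∀ j, AbsolutelyContinuousOnInterval (fun t => p t j) a b)
    (h : ∀ᵐ t, t ∈ Set.Ioo a b → ∀ j, 0 < p t j → deriv (fun t => p t j) t ≤ (M *ᵥ p t) j)
    (ha : p a ≤ 0) : p b ≤ 0 := by
  set K : ℝ := ∑ j, ∑ l, |M j l| with hK
  set Φ : ℝ → ℝ := fun t => ∑ j, (max (p t j) 0) ^ 2 with hΦ
  have hΦ0 : ∀ t, 0 ≤ Φ t := fun t => Finset.sum_nonneg fun j _ => sq_nonneg _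
  have hle : ∀ t j, (max (p t j) 0) ^ 2 ≤ Φ t := fun t j =>
    Finset.single_le_sum (f := fun j => (max (p t j) 0) ^ 2) (fun j _ => sq_nonneg _)
      (Finset.mem_univ j)
  have hΦac : AbsolutelyContinuousOnInterval Φ a b := by
    refine absolutelyContinuousOnInterval_sum _ fun j _ => ?_
    have h1 : AbsolutelyContinuousOnInterval (fun t => max (p t j) 0) a b := by
      refine absolutelyContinuousOnInterval_of_dist_le (K := 1) (hp j) fun s t => ?_
      rw [Real.dist_eq, Real.dist_eq, one_mul]
      exact abs_max_sub_max_le_abs _ _ _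
    simpa only [sq] using! h1.mul h1
  have hexp : AbsolutelyContinuousOnInterval (fun t => Real.exp (-(2 * K) * t)) a b :=
    ContDiffOn.absolutelyContinuousOnInterval (by fun_prop)
  -- Grönwall: Φ' ≤ 2KΦ almost everywhere. Only indices with `p t j > 0` contribute to Φ', which is
  -- why the differential inequality is needed only there.
  have hdecr : Real.exp (-(2 * K) * b) * Φ b ≤ Real.exp (-(2 * K) * a) * Φ a := by
    refine le_of_ae_deriv_nonpos (f := fun t => Real.exp (-(2 * K) * t) * Φ t) hab
      (hexp.fun_mul hΦac) ?_
    have hd := ae_all_iff.2 fun j => (hp j).ae_differentiableAt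
    filter_upwards [h, hd] with t ht hdt hmem
    have hmem' : t ∈ Set.uIcc a b := by
      rw [Set.uIcc_of_le hab]; exact Set.Ioo_subset_Icc_self hmem
    have h1 : HasDerivAt Φ (∑ j, 2 * max (p t j) 0 * deriv (fun t => p t j) t) t := by
      refine HasDerivAt.fun_sum fun j _ => ?_
      exact (hasDerivAt_max_zero_sq (p t j)).comp t (hdt j hmem').hasDerivAt
    have h2 : HasDerivAt (fun t => Real.exp (-(2 * K) * t))
        (Real.exp (-(2 * K) * t) * (-(2 * K))) t := by
      simpa using ((hasDerivAt_id t).const_mul (-(2 * K))).exp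
    rw [(h2.fun_mul h1).deriv]
    have h3 : ∑ j, 2 * max (p t j) 0 * deriv (fun t => p t j) t ≤ 2 * K * Φ t := by
      have hsum : 2 * K * Φ t = ∑ j, 2 * (∑ l, |M j l|) * Φ t := by
        rw [← Finset.sum_mul, ← Finset.mul_sum]
      rw [hsum]
      refine Finset.sum_le_sum fun j _ => ?_
      rcases le_or_gt (p t j) 0 with hj | hj
      · rw [max_eq_right hj, mul_zero, zero_mul]
        have : 0 ≤ ∑ l, |M j l| := Finset.sum_nonneg fun l _ => abs_nonneg _
        have := hΦ0 t
        positivity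
      · have h4 := ht hmem j hj
        have h5 : max (p t j) 0 * (M *ᵥ p t) j ≤ (∑ l, |M j l|) * Φ t := by
          rw [Matrix.mulVec, dotProduct, Finset.mul_sum, Finset.sum_mul]
          refine Finset.sum_le_sum fun l _ => ?_
          -- Off the diagonal this uses the Metzler sign; on the diagonal, where the entry may be
          -- negative, it uses `p t j > 0`.
          have h6 : M j l * p t l ≤ |M j l| * max (p t l) 0 := by
            by_cases hjl : j = l
            · subst hjl
              rw [max_eq_left hj.le]
              exact mul_le_mul_of_nonneg_right (le_abs_self _) hj.le
            · rw [abs_of_nonneg (hM j l hjl)]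
              exact mul_le_mul_of_nonneg_left (le_max_left _ _) (hM j l hjl)
          have h7 : max (p t j) 0 * max (p t l) 0 ≤ Φ t := by
            nlinarith [hle t j, hle t l, sq_nonneg (max (p t j) 0 - max (p t l) 0)]
          calc max (p t j) 0 * (M j l * p t l)
              ≤ max (p t j) 0 * (|M j l| * max (p t l) 0) :=
                mul_le_mul_of_nonneg_left h6 (le_max_right _ _)
            _ = |M j l| * (max (p t j) 0 * max (p t l) 0) := by ring
            _ ≤ |M j l| * Φ t := mul_le_mul_of_nonneg_left h7 (abs_nonneg _)
        have h8 := mul_le_mul_of_nonneg_left h4 (le_max_right (p t j) 0)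
        linarith
    have := mul_le_mul_of_nonneg_left h3 (Real.exp_pos (-(2 * K) * t)).le
    linarith
  have hΦa : Φ a = 0 := Finset.sum_eq_zero fun j _ => by
    have haj : p a j ≤ 0 := ha j
    rw [max_eq_right haj]; simp
  rw [hΦa, mul_zero] at hdecr
  have hΦb : Φ b ≤ 0 := nonpos_of_mul_nonpos_right hdecr (Real.exp_pos _)
  intro j
  have h1 := (hle b j).trans hΦb
  have h2 : max (p b j) 0 = 0 := by
    have := sq_nonneg (max (p b j) 0)
    exact pow_eq_zero_iff (two_ne_zero) |>.1 (le_antisymm h1 this)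
  exact max_eq_right_iff.1 h2

/-- Comparison with the supersolution `η + c e^{-λ (t - a)} v`. -/
theorem IsMetzler.le_add_exp_of_deriv_le {L : Matrix (Fin n) (Fin n) ℝ} (hL : IsMetzler L)
    {q : ℝ → Fin n → ℝ} {a b c lam : ℝ} {d η v : Fin n → ℝ} (hab : a ≤ b)
    (hq : ∀ j, AbsolutelyContinuousOnInterval (fun t => q t j) a b)
    (h : ∀ᵐ t, t ∈ Set.Ioo a b → ∀ j, 0 < q t j → deriv (fun t => q t j) t ≤ (L *ᵥ q t + d) j)
    (hη : 0 ≤ η) (hηd : L *ᵥ η + d ≤ 0) (hv : 0 ≤ v) (hc : 0 ≤ c) (hLv : L *ᵥ v ≤ -(lam • v))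
    (ha : q a ≤ η + c • v) :
    q b ≤ η + (c * Real.exp (-lam * (b - a))) • v := by
  set e : ℝ → ℝ := fun t => c * Real.exp (-lam * (t - a)) with he
  have he0 : ∀ t, 0 ≤ e t := fun t => mul_nonneg hc (Real.exp_pos _).le
  have key : (fun t => q t - (η + e t • v)) b ≤ 0 := by
    refine hL.nonpos_of_deriv_le (p := fun t => q t - (η + e t • v)) hab (fun j => ?_) ?_ ?_
    · simp only [Pi.sub_apply, Pi.add_apply, Pi.smul_apply, smul_eq_mul]
      exact (hq j).fun_sub (ContDiffOn.absolutelyContinuousOnInterval (by fun_prop))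
    · have hd := ae_all_iff.2 fun j => (hq j).ae_differentiableAt
      filter_upwards [h, hd] with t ht hdt hmem j hj
      have hmem' : t ∈ Set.uIcc a b := by
        rw [Set.uIcc_of_le hab]; exact Set.Ioo_subset_Icc_self hmem
      simp only [Pi.sub_apply, Pi.add_apply, Pi.smul_apply, smul_eq_mul] at hj ⊢
      -- The supersolution is nonnegative, so exceeding it forces positivity, and the hypothesis on
      -- `q` applies.
      have hqj : 0 < q t j := by
        have := hη j
        have := mul_nonneg (he0 t) (hv j)
        simp only [Pi.zero_apply] at *
        linarith
      have h1 := ht hmem j hqj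
      have h2 : HasDerivAt e (-lam * e t) t := by
        have := (((hasDerivAt_id t).sub_const a).const_mul (-lam)).exp.const_mul c
        refine this.congr_deriv ?_
        simp only [he, id]; ring
      have h3 := ((hdt j hmem').hasDerivAt.fun_sub ((h2.mul_const (v j)).const_add (η j))).deriv
      rw [h3, Matrix.mulVec_sub, Matrix.mulVec_add, Matrix.mulVec_smul]
      have h4 := hηd j
      have h5 := mul_le_mul_of_nonneg_left (hLv j) (he0 t)
      simp only [Pi.sub_apply, Pi.add_apply, Pi.smul_apply, smul_eq_mul, Pi.neg_apply,
        Pi.zero_apply] at h1 h4 h5 ⊢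
      linarith
    · intro j
      have := ha j
      simp only [he, Pi.sub_apply, Pi.add_apply, Pi.smul_apply, smul_eq_mul, Pi.zero_apply,
        sub_self, mul_zero, Real.exp_zero, mul_one] at this ⊢
      linarith
  intro j
  have := key j
  simp only [he, Pi.sub_apply, Pi.zero_apply] at this ⊢
  linarith

theorem IsMetzler.row_sum_mul_le_mulVec {M : Matrix (Fin n) (Fin n) ℝ} (hM : IsMetzler M)
    {x : Fin n → ℝ} {j : Fin n} (hx : ∀ l, x j ≤ x l) : (∑ l, M j l) * x j ≤ (M *ᵥ x) j := by
  rw [Matrix.mulVec, dotProduct, Finset.sum_mul]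
  refine Finset.sum_le_sum fun l _ => ?_
  by_cases hjl : j = l
  · subst hjl; exact le_rfl
  · exact mul_le_mul_of_nonneg_left (hx l) (hM j l hjl)

theorem IsHurwitz.isUnit_smul_one_sub {L : Matrix (Fin n) (Fin n) ℝ} (hL : IsHurwitz L) {s : ℝ}
    (hs : 0 ≤ s) : IsUnit (s • (1 : Matrix (Fin n) (Fin n) ℝ) - L) := by
  by_contra hcon
  have h1 : (s : ℂ) ∈ spectrum ℂ (toC L) := by
    rw [spectrum.mem_iff]
    intro h2
    apply hcon
    rw [Matrix.isUnit_iff_isUnit_det, isUnit_iff_ne_zero] at h2 ⊢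
    intro h3
    apply h2
    have h4 : algebraMap ℂ (Matrix (Fin n) (Fin n) ℂ) (s : ℂ) - toC L
        = (s • (1 : Matrix (Fin n) (Fin n) ℝ) - L).map Complex.ofRealHom := by
      ext j l
      by_cases hjl : j = l
      · subst hjl; simp [toC, Matrix.algebraMap_matrix_apply]
      · simp [toC, Matrix.algebraMap_matrix_apply, hjl]
    rw [h4]
    have h5 := (RingHom.map_det Complex.ofRealHom (s • (1 : Matrix (Fin n) (Fin n) ℝ) - L)).symm
    rw [h3, map_zero] at h5
    exact h5
  have := hL _ h1
  simp at this
  linarith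

theorem IsHurwitz.isUnit_det {L : Matrix (Fin n) (Fin n) ℝ} (hH : IsHurwitz L) :
    IsUnit L.det := by
  have h := hH.isUnit_smul_one_sub le_rfl
  rw [zero_smul, zero_sub] at h
  exact (Matrix.isUnit_iff_isUnit_det _).1 (by simpa using h.neg)

/-- The negated inverse of a Hurwitz Metzler matrix maps positive vectors to positive vectors. -/
theorem IsMetzler.neg_inv_mulVec_pos {L : Matrix (Fin n) (Fin n) ℝ} (hL : IsMetzler L)
    (hH : IsHurwitz L) {y : Fin n → ℝ} (hy : ∀ j, 0 < y j) (i : Fin n) :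
    0 < ((-L⁻¹) *ᵥ y) i := by
  have : Nonempty (Fin n) := ⟨i⟩
  -- Homotopy in s: the least component `m s` of (sI - L)⁻¹y is continuous on [0, ∞), never
  -- vanishes, and is positive for large s; hence it is positive at s = 0.
  set B : ℝ → Matrix (Fin n) (Fin n) ℝ := fun s => s • (1 : Matrix (Fin n) (Fin n) ℝ) - L with hB
  have hBu : ∀ s, 0 ≤ s → IsUnit (B s).det := fun s hs =>
    (Matrix.isUnit_iff_isUnit_det _).1 (hH.isUnit_smul_one_sub hs)
  set x : ℝ → Fin n → ℝ := fun s => (B s)⁻¹ *ᵥ y with hx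
  have hxB : ∀ s, 0 ≤ s → s • x s - L *ᵥ x s = y := fun s hs => by
    have h1 : B s *ᵥ x s = y := by
      rw [hx, Matrix.mulVec_mulVec, Matrix.mul_nonsing_inv _ (hBu s hs), Matrix.one_mulVec]
    rw [← h1, hB, Matrix.sub_mulVec, Matrix.smul_mulVec, Matrix.one_mulVec]
  set m : ℝ → ℝ := fun s => Finset.univ.inf' Finset.univ_nonempty (x s) with hm
  have hBc : Continuous B := (continuous_id.smul continuous_const).sub continuous_const
  have hxc : ContinuousOn x (Set.Ici 0) := by
    have h1 : ContinuousOn (fun s => ((B s).det)⁻¹ • ((B s).adjugate *ᵥ y)) (Set.Ici 0) := by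
      have hdet : ContinuousOn (fun s => ((B s).det)⁻¹) (Set.Ici 0) :=
        hBc.matrix_det.continuousOn.inv₀ fun s hs => (hBu s hs).ne_zero
      have hadj : ContinuousOn (fun s => (B s).adjugate *ᵥ y) (Set.Ici 0) :=
        (hBc.matrix_adjugate.matrix_mulVec continuous_const).continuousOn
      exact hdet.smul hadj
    refine h1.congr fun s _ => ?_
    rw [hx]
    simp only [Matrix.inv_def, Ring.inverse_eq_inv', Matrix.smul_mulVec]
  have hmc : ContinuousOn m (Set.Ici 0) :=
    ContinuousOn.finset_inf'_apply _ fun j _ => (continuous_apply j).comp_continuousOn hxc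
  have hmin : ∀ s, ∃ j, m s = x s j ∧ ∀ l, x s j ≤ x s l := fun s => by
    obtain ⟨j, _, hj⟩ := Finset.exists_mem_eq_inf' Finset.univ_nonempty (x s)
    exact ⟨j, hj, fun l => hj ▸ Finset.inf'_le _ (Finset.mem_univ l)⟩
  -- Row j of (sI - L)x = y, read at an index where x is minimal. As y is positive, this excludes `m
  -- s = 0`, and it gives `m s > 0` once s exceeds all row sums, as `s₁` does.
  have hrow : ∀ s, 0 ≤ s → ∃ j, y j ≤ (s - ∑ l, L j l) * m s := fun s hs => by
    obtain ⟨j, hj, hjl⟩ := hmin s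
    refine ⟨j, ?_⟩
    have h1 := hL.row_sum_mul_le_mulVec hjl
    have h2 := congrFun (hxB s hs) j
    simp only [Pi.sub_apply, Pi.smul_apply, smul_eq_mul] at h2
    rw [hj]; linarith
  have hne : ∀ s, 0 ≤ s → m s ≠ 0 := fun s hs h0 => by
    obtain ⟨j, hj⟩ := hrow s hs
    rw [h0, mul_zero] at hj
    exact absurd (hy j) (not_lt.2 hj)
  set s₁ : ℝ := 1 + ∑ j, |∑ l, L j l| with hs₁
  have hs₁0 : 0 ≤ s₁ := by
    have : 0 ≤ ∑ j, |∑ l, L j l| := Finset.sum_nonneg fun j _ => abs_nonneg _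
    linarith
  have hpos₁ : 0 < m s₁ := by
    obtain ⟨j, hj⟩ := hrow s₁ hs₁0
    have h1 : 0 < s₁ - ∑ l, L j l := by
      have h2 : |∑ l, L j l| ≤ ∑ j, |∑ l, L j l| :=
        Finset.single_le_sum (f := fun j => |∑ l, L j l|) (fun j _ => abs_nonneg _)
          (Finset.mem_univ j)
      have h3 := le_abs_self (∑ l, L j l)
      linarith
    exact pos_of_mul_pos_right ((hy j).trans_le hj) h1.le
  have hpos₀ : 0 < m 0 := by
    by_contra hcon
    have h1 := intermediate_value_Icc hs₁0 (hmc.mono Set.Icc_subset_Ici_self)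
    obtain ⟨s, hs, hs0⟩ := h1 ⟨not_lt.1 hcon, hpos₁.le⟩
    exact hne s hs.1 hs0
  have h0 : x 0 = (-L⁻¹) *ᵥ y := by
    have h1 : B 0 = -L := by simp [hB]
    have h2 : (-L)⁻¹ = -L⁻¹ := by
      refine Matrix.inv_eq_left_inv ?_
      rw [neg_mul_neg, Matrix.nonsing_inv_mul _ hH.isUnit_det]
    rw [hx]
    simp only [h1, h2]
  rw [← h0]
  exact hpos₀.trans_le (Finset.inf'_le _ (Finset.mem_univ i))

/-- Limit of the strictly positive case under y + ε, ε → 0⁺. -/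
theorem IsMetzler.neg_inv_mulVec_nonneg {L : Matrix (Fin n) (Fin n) ℝ} (hL : IsMetzler L)
    (hH : IsHurwitz L) {y : Fin n → ℝ} (hy : 0 ≤ y) : 0 ≤ (-L⁻¹) *ᵥ y := by
  intro i
  have h1 : Tendsto (fun ε : ℝ => ((-L⁻¹) *ᵥ (y + fun _ => ε)) i) (𝓝[>] 0)
      (𝓝 (((-L⁻¹) *ᵥ (y + fun _ => (0 : ℝ))) i)) := by
    refine (Continuous.tendsto ?_ 0).mono_left nhdsWithin_le_nhds
    exact (continuous_apply i).comp (continuous_const.matrix_mulVec (by fun_prop))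
  have h2 : y + (fun _ => (0 : ℝ)) = y := by ext; simp
  rw [h2] at h1
  refine ge_of_tendsto h1 ?_
  filter_upwards [self_mem_nhdsWithin] with ε hε
  exact (hL.neg_inv_mulVec_pos hH (fun j => add_pos_of_nonneg_of_pos (hy j) hε) i).le

theorem IsMetzler.neg_inv_mulVec_mono {L : Matrix (Fin n) (Fin n) ℝ} (hL : IsMetzler L)
    (hH : IsHurwitz L) {y z : Fin n → ℝ} (h : y ≤ z) : (-L⁻¹) *ᵥ y ≤ (-L⁻¹) *ᵥ z := by
  have := hL.neg_inv_mulVec_nonneg hH (sub_nonneg.2 h)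
  rwa [Matrix.mulVec_sub, sub_nonneg] at this

theorem IsHurwitz.mulVec_neg_inv_mulVec {L : Matrix (Fin n) (Fin n) ℝ} (hH : IsHurwitz L)
    (y : Fin n → ℝ) : L *ᵥ ((-L⁻¹) *ᵥ y) = -y := by
  rw [Matrix.neg_mulVec, Matrix.mulVec_neg, Matrix.mulVec_mulVec,
    Matrix.mul_nonsing_inv _ hH.isUnit_det, Matrix.one_mulVec]

/-- A Hurwitz Metzler matrix contracts some positive vector. -/
theorem IsMetzler.exists_pos_mulVec_le {L : Matrix (Fin n) (Fin n) ℝ} (hL : IsMetzler L)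
    (hH : IsHurwitz L) :
    ∃ v : Fin n → ℝ, (∀ j, 0 < v j) ∧ ∃ lam : ℝ, 0 < lam ∧ L *ᵥ v ≤ -(lam • v) := by
  set v : Fin n → ℝ := (-L⁻¹) *ᵥ 1 with hv
  have hpos : ∀ j, 0 < v j := hL.neg_inv_mulVec_pos hH fun _ => zero_lt_one
  have hs : 0 ≤ ∑ j, v j := Finset.sum_nonneg fun j _ => (hpos j).le
  -- Here Lv = -1, so any rate with λ vⱼ ≤ 1 for all j works; the summand 1 keeps the denominator
  -- positive even when n = 0.
  refine ⟨v, hpos, (1 + ∑ j, v j)⁻¹, by positivity, ?_⟩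
  rw [hv, hH.mulVec_neg_inv_mulVec, neg_le_neg_iff, ← hv]
  intro j
  have h1 := Finset.single_le_sum (f := v) (fun j _ => (hpos j).le) (Finset.mem_univ j)
  simp only [Pi.smul_apply, smul_eq_mul, Pi.one_apply]
  rw [inv_mul_le_one₀ (by positivity)]
  linarith

/-! ### The coordinates `V⁻¹ x` -/

theorem coordAbs_nonneg (V : Matrix (Fin n) (Fin n) ℂ) (x : Fin n → ℝ) : 0 ≤ coordAbs V x :=
  fun _ => norm_nonneg _

theorem dist_coordAbs_le (V : Matrix (Fin n) (Fin n) ℂ) (x y : Fin n → ℝ) (j : Fin n) :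
    dist (coordAbs V x j) (coordAbs V y j) ≤ (∑ l, ‖V⁻¹ j l‖) * dist x y := by
  rw [Real.dist_eq]
  refine (abs_norm_sub_norm_le _ _).trans ?_
  have h1 : (V⁻¹ *ᵥ vecC x) j - (V⁻¹ *ᵥ vecC y) j = ∑ l, V⁻¹ j l * ((x l - y l : ℝ) : ℂ) := by
    simp only [Matrix.mulVec, dotProduct, vecC, Complex.ofReal_sub, mul_sub,
      Finset.sum_sub_distrib]
  rw [h1, Finset.sum_mul]
  refine (norm_sum_le _ _).trans (Finset.sum_le_sum fun l _ => ?_)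
  rw [norm_mul, Complex.norm_real, ← dist_eq_norm]
  exact mul_le_mul_of_nonneg_left (dist_le_pi_dist x y l) (norm_nonneg _)

theorem continuous_coordAbs (V : Matrix (Fin n) (Fin n) ℂ) : Continuous (coordAbs V) := by
  have h1 : Continuous fun x : Fin n → ℝ => V⁻¹ *ᵥ vecC x :=
    continuous_const.matrix_mulVec
      (continuous_pi fun j => Complex.continuous_ofReal.comp (continuous_apply j))
  exact continuous_pi fun j => continuous_norm.comp ((continuous_apply j).comp h1)

theorem abs_le_mulVec_coordAbs {V : Matrix (Fin n) (Fin n) ℂ} (hV : IsUnit V) (x : Fin n → ℝ) :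
    |x| ≤ V.map (fun z => ‖z‖) *ᵥ coordAbs V x := by
  have hdet : IsUnit V.det := (Matrix.isUnit_iff_isUnit_det _).1 hV
  have h1 : V *ᵥ (V⁻¹ *ᵥ vecC x) = vecC x := by
    rw [Matrix.mulVec_mulVec, Matrix.mul_nonsing_inv _ hdet, Matrix.one_mulVec]
  intro j
  have h2 : |x| j = ‖(V *ᵥ (V⁻¹ *ᵥ vecC x)) j‖ := by
    rw [h1, vecC, Complex.norm_real, Real.norm_eq_abs, Pi.abs_apply]
  rw [h2]
  change ‖∑ l, V j l * (V⁻¹ *ᵥ vecC x) l‖ ≤ ∑ l, ‖V j l‖ * ‖(V⁻¹ *ᵥ vecC x) l‖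
  refine (norm_sum_le _ _).trans (Finset.sum_le_sum fun l _ => ?_)
  rw [norm_mul]

theorem vecC_mulVec {m : ℕ} (A : Matrix (Fin m) (Fin n) ℝ) (x : Fin n → ℝ) :
    vecC (A *ᵥ x) = toC A *ᵥ vecC x := by
  ext j
  simp [vecC, toC, Matrix.mulVec, dotProduct]

theorem mulVec_mono_of_nonneg {m : ℕ} {A : Matrix (Fin m) (Fin n) ℝ} (hA : ∀ j l, 0 ≤ A j l)
    {x y : Fin n → ℝ} (h : x ≤ y) : A *ᵥ x ≤ A *ᵥ y := fun j => by
  simp only [Matrix.mulVec, dotProduct]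
  exact Finset.sum_le_sum fun l _ => mul_le_mul_of_nonneg_left (h l) (hA j l)

/-! ### Componentwise maxima -/

theorem le_vmax {α : Type*} {s : Set α} {f : α → Fin n → ℝ} {a : α} (ha : a ∈ s)
    {j : Fin n} (hb : BddAbove ((fun a => f a j) '' s)) : f a j ≤ vmax s f j :=
  le_csSup hb ⟨a, ha, rfl⟩

theorem vmax_le {α : Type*} {s : Set α} {f : α → Fin n → ℝ} (hs : s.Nonempty) {c : Fin n → ℝ}
    (h : ∀ a ∈ s, f a ≤ c) : vmax s f ≤ c := fun j =>
  csSup_le (hs.image _) (by rintro _ ⟨a, ha, rfl⟩; exact h a ha j)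

/-- Neither nonemptiness nor boundedness is required, because the real `sSup` defaults to 0. -/
theorem vmax_nonneg {α : Type*} {s : Set α} {f : α → Fin n → ℝ} (h : ∀ a ∈ s, 0 ≤ f a) :
    0 ≤ vmax s f := fun j =>
  Real.sSup_nonneg (by rintro _ ⟨a, ha, rfl⟩; exact h a ha j)

/-! ### Structure of `Λ` and `ψ` -/

section

variable [NeZero N] (S : System n N) (V : Matrix (Fin n) (Fin n) ℂ)

theorem System.metzlerPart_le_lam (i : Fin N) (j l : Fin n) :
    metzlerPart (V⁻¹ * toC (S.A i) * V) j l ≤ S.Lam V j l :=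
  Finset.le_sup' (fun i : Fin N => metzlerPart (V⁻¹ * toC (S.A i) * V) j l) (Finset.mem_univ i)

theorem System.isMetzler_lam : IsMetzler (S.Lam V) := fun j l hjl => by
  refine le_trans ?_ (S.metzlerPart_le_lam V 0 j l)
  rw [metzlerPart, Matrix.of_apply, if_neg hjl]
  exact norm_nonneg _

theorem System.coordAbs_le_psi {y : Fin n → ℝ} {i : Fin N} {w : Fin (S.k i) → ℝ}
    (hw : |w| ≤ S.δ i (V.map (fun z => ‖z‖) *ᵥ y)) : coordAbs V (S.H i *ᵥ w) ≤ S.psi V y := by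
  intro j
  refine le_trans ?_ (Finset.le_sup' (fun i : Fin N =>
    vmax {w : Fin (S.k i) → ℝ | |w| ≤ S.δ i (V.map (fun z => ‖z‖) *ᵥ y)}
      (fun w => coordAbs V (S.H i *ᵥ w)) j) (Finset.mem_univ i))
  refine le_vmax (f := fun w => coordAbs V (S.H i *ᵥ w)) hw ?_
  -- The admissible perturbations lie in a compact box, so the supremum defining ψ is a genuine
  -- upper bound rather than a default value.
  have hset : {w : Fin (S.k i) → ℝ | |w| ≤ S.δ i (V.map (fun z => ‖z‖) *ᵥ y)}
      ⊆ Set.Icc (-S.δ i (V.map (fun z => ‖z‖) *ᵥ y)) (S.δ i (V.map (fun z => ‖z‖) *ᵥ y)) :=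
    fun w hw => ⟨neg_le.1 ((neg_le_abs w).trans hw), (le_abs_self w).trans hw⟩
  refine BddAbove.mono (Set.image_mono hset) ?_
  refine isCompact_Icc.bddAbove_image (Continuous.continuousOn ?_)
  exact (continuous_apply j).comp ((continuous_coordAbs V).comp
    (continuous_const.matrix_mulVec continuous_id))

/-- Growth estimate for a modulus: `|z_j|' ≤ (ℳ(M) |z|)_j + |u_j|` where `z_j ≠ 0` and
`z' = M z + u`. -/
theorem deriv_norm_le_metzlerPart {z : ℝ → Fin n → ℂ} {t : ℝ} {M : Matrix (Fin n) (Fin n) ℂ}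
    {u : Fin n → ℂ} {j : Fin n} (hz : HasDerivAt (fun t => z t j) ((M *ᵥ z t + u) j) t)
    (hj : z t j ≠ 0) :
    deriv (fun t => ‖z t j‖) t ≤ (metzlerPart M *ᵥ cabs (z t) + cabs u) j := by
  have hpos : 0 < ‖z t j‖ := norm_pos_iff.2 hj
  -- Gives |zⱼ|' = Re(z̄ⱼ zⱼ')/|zⱼ|. The diagonal term contributes exactly Re Mⱼⱼ |zⱼ|; the others
  -- are bounded by Cauchy–Schwarz.
  have h1 : HasDerivAt (fun t => √(‖z t j‖ ^ 2)) _ t :=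
    (HasDerivAt.norm_sq hz).sqrt (pow_ne_zero 2 hpos.ne')
  simp only [Real.sqrt_sq (norm_nonneg _)] at h1
  rw [h1.deriv, mul_div_mul_left _ _ two_ne_zero, div_le_iff₀ hpos]
  have h2 : (M *ᵥ z t + u) j = ∑ l, M j l * z t l + u j := rfl
  rw [h2, inner_add_right, inner_sum]
  have h3 : (metzlerPart M *ᵥ cabs (z t) + cabs u) j
      = ∑ l, metzlerPart M j l * ‖z t l‖ + ‖u j‖ := rfl
  rw [h3, add_mul, Finset.sum_mul]
  refine add_le_add (Finset.sum_le_sum fun l _ => ?_) ?_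
  · by_cases hjl : j = l
    · subst hjl
      rw [metzlerPart, Matrix.of_apply, if_pos rfl, Complex.inner, mul_assoc (M j j).re,
        ← sq, ← Complex.normSq_eq_norm_sq, Complex.normSq_apply]
      simp only [Complex.mul_re, Complex.conj_re, Complex.conj_im, Complex.mul_im]
      apply le_of_eq; ring
    · rw [metzlerPart, Matrix.of_apply, if_neg hjl]
      refine (real_inner_le_norm _ _).trans ?_
      rw [norm_mul]
      apply le_of_eq; ring
  · refine (real_inner_le_norm _ _).trans ?_
    rw [mul_comm]

end

/-! ### Trajectories -/

section

variable {S : System n N} {V : Matrix (Fin n) (Fin n) ℂ} {δ : (Fin n → ℝ) → Fin n → ℝ}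
  {σ : ℝ → Fin N} {w : (i : Fin N) → ℝ → Fin (S.k i) → ℝ} {x : ℝ → Fin n → ℝ}

theorem System.IsTrajectory.absolutelyContinuousOnInterval_coordAbs (hx : S.IsTrajectory σ w x)
    {a b : ℝ} (ha : 0 ≤ a) (hab : a ≤ b) (j : Fin n) :
    AbsolutelyContinuousOnInterval (fun t => coordAbs V (x t) j) a b := by
  have h1 := (hx.absolutelyContinuous b (ha.trans hab)).mono (c := a) (d := b) (by
    rw [Set.uIcc_of_le hab, Set.uIcc_of_le (ha.trans hab)]
    exact Set.Icc_subset_Icc_left ha)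
  exact absolutelyContinuousOnInterval_of_dist_le h1 fun s t => dist_coordAbs_le V _ _ j

theorem System.IsTrajectory.theta_le (hV : IsUnit V) {Y : Fin n → ℝ} {t : ℝ}
    (hY : ∀ s ∈ Set.Icc (t - S.τ) t, coordAbs V (x s) ≤ Y) :
    S.theta x t ≤ V.map (fun z => ‖z‖) *ᵥ Y := by
  refine vmax_le ⟨t, by simp [S.τ_nonneg]⟩ fun s hs => ?_
  exact (abs_le_mulVec_coordAbs hV (x s)).trans
    (mulVec_mono_of_nonneg (A := V.map fun z => ‖z‖) (fun j l => norm_nonneg (V j l)) (hY s hs))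

theorem System.theta_nonneg (S : System n N) (x : ℝ → Fin n → ℝ) (t : ℝ) : 0 ≤ S.theta x t :=
  vmax_nonneg fun _ _ => abs_nonneg _

variable [NeZero N]

/-- The differential inequality `q' ≤ Λ q + δ(Y)` for `q = |V⁻¹ x|` bounded by `Y` on the
delay interval. -/
theorem System.IsTrajectory.deriv_coordAbs_le (hx : S.IsTrajectory σ w x)
    (hS : ∀ i, CNI (S.δ i)) (hV : IsUnit V)
    (hδ_psi : ∀ y ∈ orthant n, S.psi V y ≤ δ y) :
    ∀ᵐ t : ℝ, 0 ≤ t → ∀ Y : Fin n → ℝ, (∀ s ∈ Set.Icc (t - S.τ) t, coordAbs V (x s) ≤ Y) →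
      ∀ j, 0 < coordAbs V (x t) j →
        deriv (fun t => coordAbs V (x t) j) t ≤ (S.Lam V *ᵥ coordAbs V (x t) + δ Y) j := by
  filter_upwards [hx.ode] with t ht ht0 Y hY j hj
  have hdet : IsUnit V.det := (Matrix.isUnit_iff_isUnit_det _).1 hV
  have hder := ht ht0
  set i := σ t with hi
  set M := V⁻¹ * toC (S.A i) * V with hM
  set u := V⁻¹ *ᵥ vecC (S.H i *ᵥ w i t) with hu
  have hmem : t ∈ Set.Icc (t - S.τ) t := ⟨by linarith [S.τ_nonneg], le_rfl⟩
  have hY0 : Y ∈ orthant n := (coordAbs_nonneg V (x t)).trans (hY t hmem)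
  have hrhs : M *ᵥ (V⁻¹ *ᵥ vecC (x t)) + u
      = V⁻¹ *ᵥ vecC (S.A i *ᵥ x t + S.H i *ᵥ w i t) := by
    have h1 : vecC (S.A i *ᵥ x t + S.H i *ᵥ w i t)
        = vecC (S.A i *ᵥ x t) + vecC (S.H i *ᵥ w i t) := by
      ext l; simp [vecC]
    rw [h1, Matrix.mulVec_add, hu, vecC_mulVec (S.A i), hM, Matrix.mulVec_mulVec,
      Matrix.mul_assoc, Matrix.mul_nonsing_inv _ hdet, Matrix.mul_one, Matrix.mulVec_mulVec]
  have hz : HasDerivAt (fun t => (V⁻¹ *ᵥ vecC (x t)) j)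
      ((M *ᵥ (V⁻¹ *ᵥ vecC (x t)) + u) j) t := by
    rw [hrhs]
    simp only [Matrix.mulVec, dotProduct]
    refine HasDerivAt.fun_sum fun l _ => ?_
    exact ((hasDerivAt_pi.1 hder l).ofReal_comp).const_mul _
  have h1 := deriv_norm_le_metzlerPart (z := fun t => V⁻¹ *ᵥ vecC (x t)) hz (norm_pos_iff.1 hj)
  refine h1.trans (add_le_add ?_ ?_)
  · simp only [Matrix.mulVec, dotProduct]
    exact Finset.sum_le_sum fun l _ =>
      mul_le_mul_of_nonneg_right (S.metzlerPart_le_lam V i j l) (norm_nonneg _)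
  · have hθ := System.IsTrajectory.theta_le (S := S) hV hY
    have h2 : |w i t| ≤ S.δ i (V.map (fun z => ‖z‖) *ᵥ Y) :=
      (hx.bound t ht0 i).trans (hS i _ (S.theta_nonneg x t) _ ((S.theta_nonneg x t).trans hθ) hθ)
    exact ((S.coordAbs_le_psi V h2).trans (hδ_psi Y hY0)) j

/-- A strict supersolution that dominates the initial history dominates the trajectory. -/
theorem System.IsTrajectory.coordAbs_le_of_supersolution (hx : S.IsTrajectory σ w x)
    (hS : ∀ i, CNI (S.δ i)) (hV : IsUnit V) (hδ_psi : ∀ y ∈ orthant n, S.psi V y ≤ δ y)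
    {β η : Fin n → ℝ} (hη : 0 ≤ η) (hηβ : SLt η β) (hsup : S.Lam V *ᵥ η + δ β ≤ 0)
    (hinit : ∀ s ∈ Set.Icc (-S.τ) 0, coordAbs V (x s) ≤ η) :
    ∀ t, -S.τ ≤ t → coordAbs V (x t) ≤ β := by
  have hcont : ContinuousOn (fun t => coordAbs V (x t)) (Set.Ici 0) :=
    (continuous_coordAbs V).comp_continuousOn
      (hx.continuousOn.mono (Set.Ici_subset_Ici.2 (neg_nonpos.2 S.τ_nonneg)))
  -- The times at which some component has reached β. This set is closed, so a first such time would
  -- exist.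
  set B : Set ℝ := ⋃ j, Set.Ici (0 : ℝ) ∩ {t | β j ≤ coordAbs V (x t) j} with hB
  have hBclosed : IsClosed B := isClosed_iUnion_of_finite fun j =>
    ((continuous_apply j).comp_continuousOn hcont).preimage_isClosed_of_isClosed isClosed_Ici
      isClosed_Ici
  have hBbdd : BddBelow B := ⟨0, fun t ht => by
    obtain ⟨j, hj⟩ := Set.mem_iUnion.1 ht
    exact hj.1⟩
  have hle : ∀ t, -S.τ ≤ t → t ∉ B → coordAbs V (x t) ≤ β := fun t ht htB j => by
    rcases le_or_gt 0 t with h0 | h0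
    · by_contra hcon
      exact htB (Set.mem_iUnion.2 ⟨j, h0, (not_le.1 hcon).le⟩)
    · exact (hinit t ⟨ht, h0.le⟩ j).trans (hηβ j).le
  have hBempty : ¬ B.Nonempty := fun hne => by
    obtain ⟨j, hj0, hj⟩ := Set.mem_iUnion.1 (hBclosed.csInf_mem hne hBbdd)
    set t₀ := sInf B with ht₀
    have hbefore : ∀ s, -S.τ ≤ s → s < t₀ → coordAbs V (x s) ≤ β := fun s hs hst =>
      hle s hs fun hsB => absurd (csInf_le hBbdd hsB) (not_le.2 hst)
    -- With `c`, `lam` and `v` all zero, the comparison function is the constant η.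
    have hcmp := (S.isMetzler_lam V).le_add_exp_of_deriv_le (q := fun t => coordAbs V (x t))
      (c := 0) (lam := 0) (v := 0) (d := δ β) hj0
      (fun j => hx.absolutelyContinuousOnInterval_coordAbs le_rfl hj0 j)
      (by
        filter_upwards [hx.deriv_coordAbs_le hS hV hδ_psi] with t ht hmem
        refine ht hmem.1.le β fun s hs => hbefore s ?_ (hs.2.trans_lt hmem.2)
        linarith [hs.1, hmem.1])
      hη hsup le_rfl le_rfl (by simp)
      (by simpa using hinit 0 ⟨neg_nonpos.2 S.τ_nonneg, le_rfl⟩)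
    have h1 := hcmp j
    simp only [smul_zero, add_zero] at h1
    have h2 : β j ≤ coordAbs V (x t₀) j := hj
    exact absurd (hηβ j) (not_lt.2 (h2.trans h1))
  exact fun t ht => hle t ht fun htB => hBempty ⟨t, htB⟩

/-- An asymptotic bound is improved by an application of `T₀`. -/
theorem System.IsTrajectory.eventually_coordAbs_le_T (hx : S.IsTrajectory σ w x)
    (hS : ∀ i, CNI (S.δ i)) (hV : IsUnit V) (hΛ : IsHurwitz (S.Lam V))
    (hδ_cont : ContinuousOn δ (orthant n)) (hδ_nonneg : ∀ y ∈ orthant n, 0 ≤ δ y)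
    (hδ_psi : ∀ y ∈ orthant n, S.psi V y ≤ δ y) {Y : Fin n → ℝ} (hY : Y ∈ orthant n)
    (h : ∀ ε > 0, ∀ᶠ t in atTop, ∀ j, coordAbs V (x t) j ≤ Y j + ε) :
    ∀ ε > 0, ∀ᶠ t in atTop, ∀ j, coordAbs V (x t) j ≤ T (S.Lam V) δ 0 Y j + ε := by
  intro ε hε
  have hL := S.isMetzler_lam V
  -- Half of ε pays for enlarging Y to Y + ε₁, by continuity of δ within the orthant; the other half
  -- absorbs the exponential transient.
  obtain ⟨ε₁, hε₁, hTε⟩ : ∃ ε₁ > 0, ∀ j,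
      T (S.Lam V) δ 0 (Y + fun _ => ε₁) j ≤ T (S.Lam V) δ 0 Y j + ε / 2 := by
    have hmaps : ∀ᶠ e : ℝ in 𝓝[>] 0, (Y + fun _ => e) ∈ orthant n := by
      filter_upwards [self_mem_nhdsWithin] with e he
      exact fun j => add_nonneg (hY j) (le_of_lt he)
    have h1 : Tendsto (fun e : ℝ => (Y + fun _ => e : Fin n → ℝ)) (𝓝[>] 0)
        (𝓝[orthant n] Y) := by
      refine tendsto_nhdsWithin_iff.2 ⟨?_, hmaps⟩
      have h2 : Continuous (fun e : ℝ => (Y + fun _ => e : Fin n → ℝ)) := by fun_prop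
      have h3 := (h2.tendsto 0).mono_left (nhdsWithin_le_nhds (s := Set.Ioi 0))
      have h4 : Y + (fun _ => (0 : ℝ)) = Y := by ext; simp
      rwa [h4] at h3
    have h2 : Tendsto (fun e : ℝ => T (S.Lam V) δ 0 (Y + fun _ => e)) (𝓝[>] 0)
        (𝓝 (T (S.Lam V) δ 0 Y)) := by
      have hc : Continuous fun y : Fin n → ℝ => (-(S.Lam V)⁻¹) *ᵥ y + 0 :=
        (continuous_const.matrix_mulVec continuous_id).add continuous_const
      exact (hc.tendsto (δ Y)).comp ((hδ_cont Y hY).tendsto.comp h1)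
    have h3 : ∀ᶠ e : ℝ in 𝓝[>] 0, ∀ j,
        T (S.Lam V) δ 0 (Y + fun _ => e) j < T (S.Lam V) δ 0 Y j + ε / 2 :=
      eventually_all.2 fun j => (tendsto_pi_nhds.1 h2 j).eventually_lt_const (by linarith)
    obtain ⟨e, he, hpos⟩ := (h3.and self_mem_nhdsWithin).exists
    exact ⟨e, hpos, fun j => (he j).le⟩
  set Y₁ : Fin n → ℝ := Y + fun _ => ε₁ with hY₁
  have hY₁0 : Y₁ ∈ orthant n := fun j => add_nonneg (hY j) hε₁.le
  set η := T (S.Lam V) δ 0 Y₁ with hη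
  have hη' : η = (-(S.Lam V)⁻¹) *ᵥ δ Y₁ := by rw [hη, T, add_zero]
  have hη0 : 0 ≤ η := hη' ▸ hL.neg_inv_mulVec_nonneg hΛ (hδ_nonneg Y₁ hY₁0)
  have hηd : S.Lam V *ᵥ η + δ Y₁ ≤ 0 := by
    rw [hη', hΛ.mulVec_neg_inv_mulVec, neg_add_cancel]
  obtain ⟨v, hv, lam, hlam, hLv⟩ := hL.exists_pos_mulVec_le hΛ
  obtain ⟨a, ha⟩ := eventually_atTop.1 ((h ε₁ hε₁).and (eventually_ge_atTop 0))
  have ha0 : 0 ≤ a := (ha a le_rfl).2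
  -- From `b` on, the whole delay window lies in [a, ∞), where the bound by `Y₁` holds.
  set b := a + S.τ with hb
  have hb0 : 0 ≤ b := add_nonneg ha0 S.τ_nonneg
  -- Large enough that c·v alone dominates the state at time `b`.
  set c := ∑ j, coordAbs V (x b) j / v j with hc
  have hc_nonneg : ∀ j, 0 ≤ coordAbs V (x b) j / v j := fun j =>
    div_nonneg (coordAbs_nonneg V _ j) (hv j).le
  have hc0 : 0 ≤ c := Finset.sum_nonneg fun j _ => hc_nonneg j
  have hqb : coordAbs V (x b) ≤ η + c • v := fun j => by
    have h1 : coordAbs V (x b) j / v j ≤ c :=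
      Finset.single_le_sum (f := fun j => coordAbs V (x b) j / v j) (fun j _ => hc_nonneg j)
        (Finset.mem_univ j)
    rw [div_le_iff₀ (hv j)] at h1
    exact h1.trans (le_add_of_nonneg_left (hη0 j))
  have hcmp : ∀ t, b ≤ t →
      coordAbs V (x t) ≤ η + (c * Real.exp (-lam * (t - b))) • v := fun t hbt => by
    refine hL.le_add_exp_of_deriv_le (q := fun t => coordAbs V (x t)) (d := δ Y₁) hbt
      (fun j => hx.absolutelyContinuousOnInterval_coordAbs hb0 hbt j) ?_ hη0 hηd
      (fun j => (hv j).le) hc0 hLv hqb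
    filter_upwards [hx.deriv_coordAbs_le hS hV hδ_psi] with r hr hmem
    refine hr (hb0.trans hmem.1.le) Y₁ fun s hs => ?_
    exact (ha s (by linarith [hs.1, hmem.1])).1
  have hdecay : Tendsto (fun t => c * Real.exp (-lam * (t - b))) atTop (𝓝 0) := by
    have h1 : Tendsto (fun t : ℝ => -lam * (t - b)) atTop atBot :=
      (tendsto_atTop_add_const_right _ (-b) tendsto_id).const_mul_atTop_of_neg (by linarith)
    simpa using (Real.tendsto_exp_atBot.comp h1).const_mul c
  have hsmall : ∀ᶠ t in atTop, ∀ j, c * Real.exp (-lam * (t - b)) * v j < ε / 2 :=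
    eventually_all.2 fun j => by
      have h1 := hdecay.mul_const (v j)
      rw [zero_mul] at h1
      exact h1.eventually_lt_const (by linarith)
  filter_upwards [hsmall, eventually_ge_atTop b] with t ht hbt j
  have h1 := hcmp t hbt j
  simp only [Pi.add_apply, Pi.smul_apply, smul_eq_mul] at h1
  linarith [ht j, hTε j]

end

/-! ### Suitable pairs and the iteration of `T₀` -/

section

variable {L : Matrix (Fin n) (Fin n) ℝ} {δ : (Fin n → ℝ) → Fin n → ℝ} {ξ β γ : Fin n → ℝ}

theorem T_zero_nonneg (hL : IsMetzler L) (hH : IsHurwitz L)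
    (hδ_nonneg : ∀ y ∈ orthant n, 0 ≤ δ y) {y : Fin n → ℝ} (hy : y ∈ orthant n) :
    T L δ 0 y ∈ orthant n := by
  change 0 ≤ T L δ 0 y
  rw [T, add_zero]
  exact hL.neg_inv_mulVec_nonneg hH (hδ_nonneg y hy)

theorem T_zero_mono (hL : IsMetzler L) (hH : IsHurwitz L) (hδ_cni : CNI δ) {y z : Fin n → ℝ}
    (hy : y ∈ orthant n) (hz : z ∈ orthant n) (h : y ≤ z) : T L δ 0 y ≤ T L δ 0 z :=
  add_le_add (hL.neg_inv_mulVec_mono hH (hδ_cni y hy z hz h)) le_rfl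

theorem Suitable.T_zero_le (hL : IsMetzler L) (hH : IsHurwitz L) (h : Suitable L δ ξ β γ) :
    T L δ 0 β ≤ β := by
  rw [T, add_zero]
  exact (hL.neg_inv_mulVec_mono hH (le_add_of_nonneg_right le_sup_right)).trans
    fun j => (h.slt j).le

/-- Write γ = -L⁻¹(-Lγ) and enlarge -Lγ to its positive part. The vector -Lγ itself need not be
nonnegative, and the positive part is what makes the result a supersolution. -/
theorem Suitable.le_supersolution (hL : IsMetzler L) (hH : IsHurwitz L)
    (h : Suitable L δ ξ β γ) : ξ ≤ (-L⁻¹) *ᵥ (δ β + (-(L *ᵥ γ)) ⊔ 0) := by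
  refine h.le_T.trans ?_
  have h1 : γ = (-L⁻¹) *ᵥ (-(L *ᵥ γ)) := by
    rw [Matrix.mulVec_neg, Matrix.neg_mulVec, neg_neg, Matrix.mulVec_mulVec,
      Matrix.nonsing_inv_mul _ hH.isUnit_det, Matrix.one_mulVec]
  rw [T, Matrix.mulVec_add]
  refine add_le_add le_rfl ?_
  conv_lhs => rw [h1]
  exact hL.neg_inv_mulVec_mono hH le_sup_left

theorem iterate_T_zero_mem (hL : IsMetzler L) (hH : IsHurwitz L)
    (hδ_nonneg : ∀ y ∈ orthant n, 0 ≤ δ y) (hβ : β ∈ orthant n) (k : ℕ) :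
    (T L δ 0)^[k] β ∈ orthant n := by
  induction k with
  | zero => exact hβ
  | succ k ih =>
    rw [Function.iterate_succ_apply']
    exact T_zero_nonneg hL hH hδ_nonneg ih

theorem antitone_iterate_T_zero (hL : IsMetzler L) (hH : IsHurwitz L)
    (hδ_nonneg : ∀ y ∈ orthant n, 0 ≤ δ y) (hδ_cni : CNI δ) (hβ : β ∈ orthant n)
    (h : T L δ 0 β ≤ β) : Antitone fun k : ℕ => (T L δ 0)^[k] β := by
  refine antitone_nat_of_succ_le fun k => ?_
  induction k with
  | zero => exact h
  | succ k ih =>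
    rw [Function.iterate_succ_apply', Function.iterate_succ_apply' _ k]
    exact T_zero_mono hL hH hδ_cni
      (by simpa only [Function.iterate_succ_apply'] using
        iterate_T_zero_mem hL hH hδ_nonneg hβ (k + 1))
      (iterate_T_zero_mem hL hH hδ_nonneg hβ k)
      (by simpa only [Function.iterate_succ_apply'] using ih)

theorem exists_tendsto_iterate_T_zero (hL : IsMetzler L) (hH : IsHurwitz L)
    (hδ_nonneg : ∀ y ∈ orthant n, 0 ≤ δ y) (hδ_cni : CNI δ) (hβ : β ∈ orthant n)
    (h : T L δ 0 β ≤ β) : ∃ b, Tendsto (fun k : ℕ => (T L δ 0)^[k] β) atTop (𝓝 b) := by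
  have hanti := antitone_iterate_T_zero hL hH hδ_nonneg hδ_cni hβ h
  refine ⟨fun j => ⨅ k : ℕ, (T L δ 0)^[k] β j, tendsto_pi_nhds.2 fun j => ?_⟩
  refine tendsto_atTop_ciInf (fun k l hkl => hanti hkl j) ⟨0, ?_⟩
  rintro _ ⟨k, rfl⟩
  exact iterate_T_zero_mem hL hH hδ_nonneg hβ k j

end

end Switching

end

theorem mainTheorem5 {n N : ℕ} [NeZero N] (S : Switching.System n N)
    (hS : ∀ i, Switching.CNI (S.δ i))
    (V : Matrix (Fin n) (Fin n) ℂ) (hV : IsUnit V)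
    (hΛ : Switching.IsHurwitz (S.Lam V))
    (δ : (Fin n → ℝ) → Fin n → ℝ)
    (hδ_cont : ContinuousOn δ (Switching.orthant n))
    (hδ_nonneg : ∀ y ∈ Switching.orthant n, 0 ≤ δ y)
    (hδ_cni : Switching.CNI δ)
    (hδ_psi : ∀ y ∈ Switching.orthant n, S.psi V y ≤ δ y)
    (hsg : ∀ ξ ∈ Switching.orthant n, ∃ β γ, Switching.Suitable (S.Lam V) δ ξ β γ)
    (σ : ℝ → Fin N) (w : (i : Fin N) → ℝ → Fin (S.k i) → ℝ) (x : ℝ → Fin n → ℝ)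
    (hx : S.IsTrajectory σ w x) :
    (∃ β γ, Switching.Suitable (S.Lam V) δ
      (Switching.vmax (Set.Icc (-S.τ) 0) fun t => Switching.coordAbs V (x t)) β γ) ∧
    ∀ β γ, Switching.Suitable (S.Lam V) δ
      (Switching.vmax (Set.Icc (-S.τ) 0) fun t => Switching.coordAbs V (x t)) β γ →
      ∃ b : Fin n → ℝ,
        Tendsto (fun k : ℕ => (Switching.T (S.Lam V) δ 0)^[k] β) atTop (𝓝 b) ∧
        ∀ j, IsBoundedUnder (· ≤ ·) atTop (fun t : ℝ => Switching.coordAbs V (x t) j) ∧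
          limsup (fun t : ℝ => Switching.coordAbs V (x t) j) atTop ≤ b j := by
  have hL := S.isMetzler_lam V
  refine ⟨hsg _ (Switching.vmax_nonneg fun t _ => Switching.coordAbs_nonneg V (x t)),
    fun β γ hβγ => ?_⟩
  have hTβ := hβγ.T_zero_le hL hΛ
  obtain ⟨b, hb⟩ :=
    Switching.exists_tendsto_iterate_T_zero hL hΛ hδ_nonneg hδ_cni hβγ.β_mem hTβ
  have hinit : ∀ s ∈ Set.Icc (-S.τ) 0, Switching.coordAbs V (x s) ≤
      (-(S.Lam V)⁻¹) *ᵥ (δ β + (-(S.Lam V *ᵥ γ)) ⊔ 0) := fun s hs => by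
    refine le_trans (fun j => ?_) (hβγ.le_supersolution hL hΛ)
    refine Switching.le_vmax (f := fun t => Switching.coordAbs V (x t)) hs ?_
    exact isCompact_Icc.bddAbove_image ((continuous_apply j).comp_continuousOn
      ((Switching.continuous_coordAbs V).comp_continuousOn
        (hx.continuousOn.mono Set.Icc_subset_Ici_self)))
  have hbound : ∀ t, -S.τ ≤ t → Switching.coordAbs V (x t) ≤ β :=
    hx.coordAbs_le_of_supersolution hS hV hδ_psi
      (hL.neg_inv_mulVec_nonneg hΛ (add_nonneg (hδ_nonneg β hβγ.β_mem) le_sup_right)) hβγ.slt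
      (by
        rw [hΛ.mulVec_neg_inv_mulVec, neg_add_rev, add_assoc, neg_add_cancel, add_zero]
        exact neg_nonpos.2 le_sup_right)
      hinit
  have hevent : ∀ t ∈ Set.Ici (0 : ℝ), Switching.coordAbs V (x t) ≤ β := fun t ht =>
    hbound t ((neg_nonpos.2 S.τ_nonneg).trans ht)
  have hiter : ∀ k : ℕ, ∀ ε > 0, ∀ᶠ t in atTop, ∀ j,
      Switching.coordAbs V (x t) j ≤ (Switching.T (S.Lam V) δ 0)^[k] β j + ε := fun k => by
    induction k with
    | zero =>
      intro ε hε
      filter_upwards [Ici_mem_atTop (0 : ℝ)] with t ht j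
      exact (hevent t ht j).trans (le_add_of_nonneg_right hε.le)
    | succ k ih =>
      rw [Function.iterate_succ_apply']
      exact hx.eventually_coordAbs_le_T hS hV hΛ hδ_cont hδ_nonneg hδ_psi
        (Switching.iterate_T_zero_mem hL hΛ hδ_nonneg hβγ.β_mem k) ih
  refine ⟨b, hb, fun j => ⟨⟨β j, ?_⟩, ?_⟩⟩
  · rw [eventually_map]
    filter_upwards [Ici_mem_atTop (0 : ℝ)] with t ht
    exact hevent t ht j
  · refine le_of_forall_pos_le_add fun ε hε => ?_
    -- The lower bound 0 ensures that the real `limsup` is not a default value when it is bounded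
    -- above by eventual estimates.
    have hco : IsCoboundedUnder (· ≤ ·) atTop fun t : ℝ => Switching.coordAbs V (x t) j :=
      IsBoundedUnder.isCoboundedUnder_le
        ⟨0, eventually_map.2 (Eventually.of_forall fun t => Switching.coordAbs_nonneg V (x t) j)⟩
    -- A single iterate within ε/2 of the limit suffices, so no uniformity in k is needed.
    obtain ⟨k, hk⟩ := ((tendsto_pi_nhds.1 hb j).eventually_lt_const
      (show b j < b j + ε / 2 by linarith)).exists
    refine limsup_le_of_le hco ?_
    filter_upwards [hiter k (ε / 2) (by linarith)] with t ht
    linarith [ht j]
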